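/- Let $d\ge 1$ and let $T=(T_1,\ldots,T_d)$ be a commuting $d$-tuple of operators on a finite-dimensional complex Hilbert space $\mathfrak H$ that is a row contraction ($\|\sum_k T_k\xi_k\|^2\le\sum_k\|\xi_k\|^2$ for all $\xi_1,\ldots,\xi_d\in\mathfrak H$), pure ($\lim_{n\to\infty}\sum_{|w|=n}\|T_w^*\xi\|^2=0$ for every $\xi\in\mathfrak H$, where $w=i_1\cdots i_n$ runs over the words of length $n$ in $\{1,\ldots,d\}$ and $T_w=T_{i_1}\cdots T_{i_n}$) and cyclic (for some $\xi\in\mathfrak H$ the vectors $T_w\xi$, $w$ any word, span a dense subspace of $\mathfrak H$). Let $\mathcal M_d$ be the multiplier algebra of the Drury--Arveson space $H^2_d$ (the Hilbert space of analytic functions on the unit ball of $\mathbb C^d$ with orthonormal basis $(|\alpha|!/\alpha!)^{1/2}x^\alpha$, $\alpha\in\mathbb N^d$), viewed as a weak-$*$ closed subalgebra of $B(H^2_d)$. For a pure commuting row contraction $S=(S_1,\ldots,S_d)$ on a Hilbert space $\mathfrak K$, let $\varphi\mapsto\varphi(S)$ be the unique weak-$*$ continuous unital homomorphism $\mathcal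 M_d\to B(\mathfrak K)$ that sends each coordinate function $x_k$ to $S_k$, and let $\operatorname{Ann}_{\mathrm c}(S)=\{\varphi\in\mathcal M_d:\varphi(S)=0\}$. Let $\mathfrak M,\mathfrak N\subset\mathfrak H$ be subspaces that are co-invariant for $T$ (that is, invariant for $T_1^*,\ldots,T_d^*$), and let $P_{\mathfrak M}T|_{\mathfrak M}=(P_{\mathfrak M}T_1|_{\mathfrak M},\ldots,P_{\mathfrak M}T_d|_{\mathfrak M})$ and $P_{\mathfrak N}T|_{\mathfrak N}$ be the compressed tuples, where $P$ denotes orthogonal projection. If $$\operatorname{Ann}_{\mathrm c}(P_{\mathfrak M}T|_{\mathfrak M})=\operatorname{Ann}_{\mathrm c}(P_{\mathfrak N}T|_{\mathfrak N}),$$ then $\mathfrak M=\mathfrak N$. -/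

import Mathlib

open Filter Topology

noncomputable section

/-! ### The Drury-Arveson space and its multiplier algebra -/

namespace DruryArveson

/-- The open unit ball of `ℂ^d`. -/
abbrev Ball (d : ℕ) : Type := Metric.ball (0 : EuclideanSpace ℂ (Fin d)) 1

/-- The function `(|α|! / α!)^{1/2} x^α` on `ℂ^d`; these functions, for `α` ranging over the
multi-indices, form the standard orthonormal basis of the Drury-Arveson space. -/
def basisFun {d : ℕ} (α : Fin d → ℕ) (z : EuclideanSpace ℂ (Fin d)) : ℂ :=
  (Real.sqrt (((∑ i, α i).factorial : ℝ) / ((∏ i, (α i).factorial : ℕ) : ℝ)) : ℂ) *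
    ∏ i, z i ^ α i

/-- The Drury-Arveson space `H²_d`, given by the coordinates of its elements with respect to the
orthonormal basis `basisFun α`: the family `a ∈ ℓ²` stands for the analytic function
`∑ a_α (|α|!/α!)^{1/2} x^α` on the ball, see `DruryArveson.eval`.  In terms of the power series
coefficients `c_α = a_α (|α|!/α!)^{1/2}` the squared norm is `∑ (α!/|α|!) |c_α|²`. -/
abbrev Space (d : ℕ) : Type := lp (fun _ : Fin d → ℕ => ℂ) 2

/-- The value at `z` of the function on the ball represented by `f`. -/
def eval {d : ℕ} (f : Space d) (z : Ball d) : ℂ := ∑' α, f α * basisFun α z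

theorem norm_basisFun_sq {d : ℕ} (α : Fin d → ℕ) (z : EuclideanSpace ℂ (Fin d)) :
    ‖basisFun α z‖ ^ 2 = Nat.multinomial Finset.univ α * ∏ i, (‖z i‖ ^ 2) ^ α i := by
  have h : (((∑ i, α i).factorial : ℝ) / ((∏ i, (α i).factorial : ℕ) : ℝ)) =
      Nat.multinomial Finset.univ α := by
    rw [← Nat.multinomial_spec Finset.univ α]
    have : ((∏ i, (α i).factorial : ℕ) : ℝ) ≠ 0 := by
      exact_mod_cast Finset.prod_ne_zero_iff.2 fun i _ => Nat.factorial_ne_zero _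
    push_cast at this ⊢
    field_simp
  rw [basisFun, h, norm_mul, mul_pow, Complex.norm_real, Real.norm_of_nonneg (Real.sqrt_nonneg _),
    Real.sq_sqrt (Nat.cast_nonneg _), norm_prod, ← Finset.prod_pow]
  congr 1
  refine Finset.prod_congr rfl fun i _ => ?_
  rw [norm_pow, pow_right_comm]

theorem summable_norm_basisFun_sq {d : ℕ} (z : Ball d) :
    Summable fun α : Fin d → ℕ => ‖basisFun α z‖ ^ 2 := by
  obtain ⟨z, hz⟩ := z
  have hz1 : ‖z‖ ^ 2 < 1 := by
    have : ‖z‖ < 1 := by simpa using hz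
    exact pow_lt_one₀ (norm_nonneg _) this two_ne_zero
  have hlevel (n : ℕ) : ∑ α ∈ Finset.piAntidiag Finset.univ n, ‖basisFun α z‖ ^ 2
      = (‖z‖ ^ 2) ^ n := by
    rw [EuclideanSpace.norm_sq_eq, Finset.sum_pow_eq_sum_piAntidiag]
    exact Finset.sum_congr rfl fun α _ => norm_basisFun_sq α z
  refine summable_of_sum_le (c := (1 - ‖z‖ ^ 2)⁻¹) (fun _ => by positivity) fun s => ?_
  set N := s.sup fun α => ∑ i, α i
  calc ∑ α ∈ s, ‖basisFun α z‖ ^ 2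
      ≤ ∑ α ∈ (Finset.range (N + 1)).biUnion fun n =>
          Finset.piAntidiag (Finset.univ : Finset (Fin d)) n, ‖basisFun α z‖ ^ 2 := by
        refine Finset.sum_le_sum_of_subset_of_nonneg (fun α hα => ?_) fun _ _ _ => by positivity
        simp only [Finset.mem_biUnion, Finset.mem_range, Finset.mem_piAntidiag]
        exact ⟨∑ i, α i, Nat.lt_succ_of_le (Finset.le_sup (f := fun α => ∑ i, α i) hα), rfl,
          fun i _ => Finset.mem_univ i⟩
    _ ≤ ∑ n ∈ Finset.range (N + 1), (‖z‖ ^ 2) ^ n := by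
        rw [Finset.sum_biUnion]
        · exact (Finset.sum_congr rfl fun n _ => hlevel n).le
        · intro m _ n _ hmn
          refine Finset.disjoint_left.2 fun α hm hn => hmn ?_
          rw [Finset.mem_piAntidiag] at hm hn
          exact hm.1.symm.trans hn.1
    _ ≤ (1 - ‖z‖ ^ 2)⁻¹ := by
        rw [← tsum_geometric_of_lt_one (by positivity) hz1]
        exact (summable_geometric_of_lt_one (by positivity) hz1).sum_le_tsum _
          fun _ _ => by positivity

/-- The series defining `eval f z` converges absolutely. -/
theorem summable_eval {d : ℕ} (f : Space d) (z : Ball d) :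
    Summable fun α => f α * basisFun α z := by
  have hf : Summable fun α => ‖f α‖ ^ 2 := by
    simpa using (lp.memℓp f).summable (by norm_num)
  refine Summable.of_norm (Summable.of_nonneg_of_le (fun _ => norm_nonneg _) (fun α => ?_)
    (hf.add (summable_norm_basisFun_sq z)))
  rw [norm_mul]
  nlinarith [sq_nonneg (‖f α‖ - ‖basisFun α (z : EuclideanSpace ℂ (Fin d))‖),
    sq_nonneg (‖f α‖), sq_nonneg ‖basisFun α (z : EuclideanSpace ℂ (Fin d))‖]

theorem eval_add {d : ℕ} (f g : Space d) (z : Ball d) : eval (f + g) z = eval f z + eval g z := by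
  rw [eval, eval, eval, ← (summable_eval f z).tsum_add (summable_eval g z)]
  exact tsum_congr fun α => by rw [lp.coeFn_add, Pi.add_apply, add_mul]

theorem eval_smul {d : ℕ} (c : ℂ) (f : Space d) (z : Ball d) :
    eval (c • f) z = c * eval f z := by
  rw [eval, eval, ← tsum_mul_left]
  exact tsum_congr fun α => by rw [lp.coeFn_smul, Pi.smul_apply, smul_eq_mul, mul_assoc]

/-- The multiplier algebra `𝓜_d` of the Drury-Arveson space, each multiplier `φ` being identified
with its multiplication operator `M_φ : f ↦ φ f`. -/
def multiplierAlgebra (d : ℕ) : Subalgebra ℂ (Space d →L[ℂ] Space d) where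
  carrier := {A | ∃ φ : Ball d → ℂ, ∀ f z, eval (A f) z = φ z * eval f z}
  mul_mem' := by
    rintro A B ⟨φ, hφ⟩ ⟨ψ, hψ⟩
    exact ⟨φ * ψ, fun f z => by
      rw [mul_apply_eq_comp, hφ, hψ, Pi.mul_apply, mul_assoc]⟩
  add_mem' := by
    rintro A B ⟨φ, hφ⟩ ⟨ψ, hψ⟩
    exact ⟨φ + ψ, fun f z => by
      rw [add_apply, eval_add, hφ, hψ, Pi.add_apply, add_mul]⟩
  algebraMap_mem' c :=
    ⟨fun _ => c, fun f z => by
      rw [Algebra.algebraMap_eq_smul_one, smul_apply,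
        one_apply_eq_self, eval_smul]⟩

/-- The coordinates of `x_k f`. -/
def shiftFun {d : ℕ} (k : Fin d) (f : (Fin d → ℕ) → ℂ) (β : Fin d → ℕ) : ℂ :=
  (Real.sqrt ((β k : ℝ) / ((∑ i, β i : ℕ) : ℝ)) : ℂ) * f (β - Pi.single k 1)

theorem sum_shiftFun_le {d : ℕ} (k : Fin d) (f : Space d) (s : Finset (Fin d → ℕ)) :
    ∑ β ∈ s, ‖shiftFun k f β‖ ^ (2 : ENNReal).toReal ≤ ‖f‖ ^ (2 : ENNReal).toReal := by
  classical
  have h0 : ∀ β : Fin d → ℕ, β k = 0 → shiftFun k f β = 0 := fun β h => by simp [shiftFun, h]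
  have h1 : ∀ β : Fin d → ℕ, ‖shiftFun k f β‖ ≤ ‖f (β - Pi.single k 1)‖ := fun β => by
    rw [shiftFun, norm_mul, Complex.norm_real, Real.norm_of_nonneg (Real.sqrt_nonneg _)]
    refine mul_le_of_le_one_left (norm_nonneg _) (Real.sqrt_le_one.2 ?_)
    refine div_le_one_of_le₀ ?_ (Nat.cast_nonneg _)
    exact_mod_cast Finset.single_le_sum (f := β) (fun _ _ => Nat.zero_le _) (Finset.mem_univ k)
  calc ∑ β ∈ s, ‖shiftFun k f β‖ ^ (2 : ENNReal).toReal
      = ∑ β ∈ s with β k ≠ 0, ‖shiftFun k f β‖ ^ (2 : ENNReal).toReal := by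
        refine (Finset.sum_filter_of_ne (p := fun β : Fin d → ℕ => β k ≠ 0) ?_).symm
        intro β _ hβ hk
        exact hβ (by simp [h0 β hk])
    _ ≤ ∑ β ∈ s with β k ≠ 0, ‖f (β - Pi.single k 1)‖ ^ (2 : ENNReal).toReal :=
        Finset.sum_le_sum fun β _ => Real.rpow_le_rpow (norm_nonneg _) (h1 β) (by norm_num)
    _ = ∑ α ∈ (s.filter fun β => β k ≠ 0).image fun β => β - Pi.single k 1,
          ‖f α‖ ^ (2 : ENNReal).toReal := by
        refine (Finset.sum_image (g := fun β : Fin d → ℕ => β - Pi.single k 1)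
          (f := fun α => ‖f α‖ ^ (2 : ENNReal).toReal) ?_).symm
        intro β hβ γ hγ h
        have hβ' := (Finset.mem_filter.1 hβ).2
        have hγ' := (Finset.mem_filter.1 hγ).2
        funext i
        have hi := congrFun h i
        by_cases hik : i = k
        · subst hik
          simp at hi
          omega
        · simpa [hik] using hi
    _ ≤ ‖f‖ ^ (2 : ENNReal).toReal := lp.sum_rpow_le_norm_rpow (by norm_num) f _

/-- The operator `M_{x_k}` of multiplication by the `k`-th coordinate function, see
`DruryArveson.eval_shift`. -/
def shift {d : ℕ} (k : Fin d) : Space d →L[ℂ] Space d :=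
  LinearMap.mkContinuous
    { toFun := fun f => ⟨shiftFun k f, memℓp_gen' (sum_shiftFun_le k f)⟩
      map_add' := fun f g => by
        ext β
        exact mul_add _ (f (β - Pi.single k 1)) (g (β - Pi.single k 1))
      map_smul' := fun c f => by
        ext β
        exact mul_left_comm _ c (f (β - Pi.single k 1)) }
    1 fun f => by
      rw [one_mul]
      exact lp.norm_le_of_forall_sum_le (by norm_num) (norm_nonneg _) (sum_shiftFun_le k f)

theorem shift_apply {d : ℕ} (k : Fin d) (f : Space d) (β : Fin d → ℕ) :
    shift k f β = shiftFun k f β := rfl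

theorem basisFun_add_single {d : ℕ} (k : Fin d) (α : Fin d → ℕ) (z : EuclideanSpace ℂ (Fin d)) :
    (Real.sqrt (((α + Pi.single k 1 : Fin d → ℕ) k : ℕ) / ((∑ i, (α + Pi.single k 1 : Fin d → ℕ) i : ℕ) : ℝ)) : ℂ) *
      basisFun (α + Pi.single k 1) z = z k * basisFun α z := by
  have hsum : ∑ i, (α + Pi.single k 1 : Fin d → ℕ) i = (∑ i, α i) + 1 := by
    simp [Finset.sum_add_distrib]
  have hfac : ∏ i, ((α + Pi.single k 1 : Fin d → ℕ) i).factorial = (α k + 1) * ∏ i, (α i).factorial := by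
    rw [← Finset.mul_prod_erase _ _ (Finset.mem_univ k),
      ← Finset.mul_prod_erase _ (fun i => (α i).factorial) (Finset.mem_univ k), ← mul_assoc]
    congr 1
    · simp [Nat.factorial_succ]
    · refine Finset.prod_congr rfl fun i hi => ?_
      simp [Finset.ne_of_mem_erase hi]
  have hpow : ∏ i, z i ^ (α + Pi.single k 1 : Fin d → ℕ) i = z k * ∏ i, z i ^ α i := by
    rw [← Finset.mul_prod_erase _ _ (Finset.mem_univ k),
      ← Finset.mul_prod_erase _ (fun i => z i ^ α i) (Finset.mem_univ k), ← mul_assoc]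
    congr 1
    · simp [pow_succ']
    · refine Finset.prod_congr rfl fun i hi => ?_
      simp [Finset.ne_of_mem_erase hi]
  rw [basisFun, basisFun, hsum, hfac, hpow, ← mul_assoc, ← Complex.ofReal_mul,
    ← Real.sqrt_mul (by positivity)]
  have : (((α + Pi.single k 1 : Fin d → ℕ) k : ℕ) : ℝ) / (((∑ i, α i) + 1 : ℕ) : ℝ) *
      ((((∑ i, α i) + 1).factorial : ℝ) / (((α k + 1) * ∏ i, (α i).factorial : ℕ) : ℝ)) =
      ((∑ i, α i).factorial : ℝ) / ((∏ i, (α i).factorial : ℕ) : ℝ) := by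
    have h1 : ((∏ i, (α i).factorial : ℕ) : ℝ) ≠ 0 := by
      exact_mod_cast Finset.prod_ne_zero_iff.2 fun i _ => Nat.factorial_ne_zero _
    have h2 : ((α k : ℝ) + 1) ≠ 0 := by positivity
    have h3 : (((∑ i, α i : ℕ) : ℝ) + 1) ≠ 0 := by positivity
    have h4 : (α + Pi.single k 1 : Fin d → ℕ) k = α k + 1 := by simp
    rw [h4, Nat.factorial_succ, Nat.cast_mul (α k + 1), Nat.cast_mul ((∑ i, α i) + 1),
      Nat.cast_succ, Nat.cast_succ]
    field_simp
  rw [this]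
  ring

theorem eval_shift {d : ℕ} (k : Fin d) (f : Space d) (z : Ball d) :
    eval (shift k f) z = (z : EuclideanSpace ℂ (Fin d)) k * eval f z := by
  have hinj : Function.Injective fun α : Fin d → ℕ => α + Pi.single k 1 :=
    add_left_injective _
  rw [eval, eval, ← tsum_mul_left, ← hinj.tsum_eq]
  · refine tsum_congr fun α => ?_
    rw [shift_apply, shiftFun, add_tsub_cancel_right, mul_right_comm, basisFun_add_single]
    ring
  · intro β hβ
    refine ⟨β - Pi.single k 1, ?_⟩
    have hk : β k ≠ 0 := fun h => hβ (by simp [shift_apply, shiftFun, h])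
    funext i
    by_cases hik : i = k
    · subst hik
      simp
      omega
    · simp [hik]

/-- The coordinate function `x_k` as an element of the multiplier algebra. -/
def coord {d : ℕ} (k : Fin d) : multiplierAlgebra d :=
  ⟨shift k, fun z => (z : EuclideanSpace ℂ (Fin d)) k, eval_shift k⟩

end DruryArveson

/-! ### Weak-* topologies -/

/-- The weak-* (ultraweak) topology of `B(H)`, as the dual of the trace class operators: the
coarsest topology that makes the functionals `A ↦ ∑ ⟨A ξ_n, η_n⟩` continuous, for all sequences
`ξ, η` in `H` with `∑ ‖ξ_n‖² < ∞` and `∑ ‖η_n‖² < ∞`. -/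
@[reducible] def weakStarTopology (H : Type*) [NormedAddCommGroup H] [InnerProductSpace ℂ H] :
    TopologicalSpace (H →L[ℂ] H) :=
  ⨅ p : lp (fun _ : ℕ => H) 2 × lp (fun _ : ℕ => H) 2,
    TopologicalSpace.induced (fun A => ∑' n, inner ℂ (p.2 n) (A (p.1 n))) inferInstance

/-- The weak-* topology of the (weak-* closed) multiplier algebra, inherited from `B(H²_d)`. -/
@[reducible] def DruryArveson.multiplierWeakStar (d : ℕ) :
    TopologicalSpace (DruryArveson.multiplierAlgebra d) :=
  TopologicalSpace.induced Subtype.val (weakStarTopology (DruryArveson.Space d))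

/-! ### Tuples of operators -/

namespace OperatorTuple

variable {d : ℕ} {H : Type*} [NormedAddCommGroup H] [InnerProductSpace ℂ H]

/-- The product `T_{i₁} T_{i₂} ⋯ T_{iₛ}` along the word `w = i₁ i₂ ⋯ iₛ`. -/
def wordProd (T : Fin d → H →L[ℂ] H) (w : List (Fin d)) : H →L[ℂ] H := (w.map T).prod

/-- The row operator `[T_1, …, T_d] : H^(d) → H` is contractive. -/
def IsRowContraction (T : Fin d → H →L[ℂ] H) : Prop :=
  ∀ ξ : Fin d → H, ‖∑ k, T k (ξ k)‖ ^ 2 ≤ ∑ k, ‖ξ k‖ ^ 2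

/-- The operators of the tuple commute with each other. -/
def IsCommuting (T : Fin d → H →L[ℂ] H) : Prop := ∀ i j, T i * T j = T j * T i

/-- Purity: `∑_{|w| = n} ‖T_w^* ξ‖² → 0` as `n → ∞`, for every `ξ`. -/
def IsPure [CompleteSpace H] (T : Fin d → H →L[ℂ] H) : Prop :=
  ∀ ξ : H, Tendsto (fun n : ℕ => ∑ w : Fin n → Fin d,
    ‖ContinuousLinearMap.adjoint (wordProd T (List.ofFn w)) ξ‖ ^ 2) atTop (𝓝 0)

/-- The tuple has a cyclic vector. -/
def IsCyclic (T : Fin d → H →L[ℂ] H) : Prop :=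
  ∃ ξ : H, (Submodule.span ℂ (Set.range fun w : List (Fin d) => wordProd T w ξ)).topologicalClosure
    = ⊤

/-- The subspace `M` is co-invariant: it is invariant under each `T_k^*`. -/
def IsCoinvariant [CompleteSpace H] (T : Fin d → H →L[ℂ] H) (M : Submodule ℂ H) : Prop :=
  ∀ k, ∀ ξ ∈ M, ContinuousLinearMap.adjoint (T k) ξ ∈ M

/-- The compressed tuple `P_M T|_M = (P_M T_1|_M, …, P_M T_d|_M)` on `M`. -/
def compression (T : Fin d → H →L[ℂ] H) (M : Submodule ℂ H) [M.HasOrthogonalProjection] :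
    Fin d → M →L[ℂ] M :=
  fun k => M.orthogonalProjectionOnto ∘L T k ∘L M.subtypeL

/-- `Φ` is the functional calculus `φ ↦ φ(T)` of the tuple `T` on the multiplier algebra, that is
the weak-* continuous unital homomorphism with `x_k ↦ T_k`.  There is at most one, because the
polynomials are weak-* dense in the multiplier algebra. -/
structure IsFunctionalCalculus (T : Fin d → H →L[ℂ] H)
    (Φ : DruryArveson.multiplierAlgebra d →ₐ[ℂ] (H →L[ℂ] H)) : Prop where
  map_coord : ∀ k, Φ (DruryArveson.coord k) = T k
  weakStar_continuous :
    @Continuous _ _ (DruryArveson.multiplierWeakStar d) (weakStarTopology H) Φ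

/-- The commutative annihilator `Ann_c(T)`: the multipliers `φ` with `φ(T) = 0`. -/
def annihilator (T : Fin d → H →L[ℂ] H) : Set (DruryArveson.multiplierAlgebra d) :=
  {φ | ∃ Φ : DruryArveson.multiplierAlgebra d →ₐ[ℂ] (H →L[ℂ] H),
    IsFunctionalCalculus T Φ ∧ Φ φ = 0}

end OperatorTuple

end

/-! Let ξ be a cyclic vector. In finite dimensions every x is F(T)ξ for some polynomial F.
Co-invariance of M gives P_M F(T) = F(T_M) P_M, where T_M is the compression, so F(T_M) = 0 implies
F(T)ξ ∈ Mᗮ. Conversely, if P_M F(T)ξ = 0, commutativity gives F(T_M) P_M G(T)ξ = G(T_M) P_M F(T)ξ =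
0 for every G, hence F(T_M) = 0. Thus Mᗮ = {F(T)ξ : F(T_M) = 0} is determined by the polynomials in
the annihilator (`lift_compression_eq_zero_iff`).

Membership in `annihilator` asks for a functional calculus to exist, so one has to be constructed
for each compression. For a pure commuting S on a finite-dimensional space, ‖S_w^*η‖² is summable
over all words w; grouped by multi-index, this says that the weighted powers S^α are square summable
(`IsPure.summable_norm_power`). Hence f ↦ f(S) is bounded on H²_d by Cauchy–Schwarz, and φ ↦
(φ·1)(S) is the calculus. It is multiplicative because multipliers commute with the shifts and 1 is
cyclic for them, and weak-* continuous by Riesz representation. -/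

noncomputable section

/-! ### Functions determine their coefficients; multipliers and the cyclic vector 1. -/

namespace DruryArveson

variable {d : ℕ}

/-- The degree `n` part of the function represented by `f`. -/
def homogeneousPart (f : Space d) (n : ℕ) (z : EuclideanSpace ℂ (Fin d)) : ℂ :=
  ∑ α ∈ Finset.piAntidiag Finset.univ n, f α * basisFun α z

theorem basisFun_smul (α : Fin d → ℕ) (t : ℂ) (z : EuclideanSpace ℂ (Fin d)) :
    basisFun α (t • z) = t ^ (∑ i, α i) * basisFun α z := by
  simp only [basisFun, PiLp.smul_apply, smul_eq_mul, mul_pow, Finset.prod_mul_distrib,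
    Finset.prod_pow_eq_pow_sum]
  ring

theorem homogeneousPart_smul (f : Space d) (n : ℕ) (t : ℂ) (z : EuclideanSpace ℂ (Fin d)) :
    homogeneousPart f n (t • z) = t ^ n * homogeneousPart f n z := by
  rw [homogeneousPart, homogeneousPart, Finset.mul_sum]
  refine Finset.sum_congr rfl fun α hα => ?_
  rw [basisFun_smul, (Finset.mem_piAntidiag.1 hα).1]
  ring

theorem hasSum_homogeneousPart (f : Space d) (z : Ball d) :
    HasSum (fun n => homogeneousPart f n z) (eval f z) := by
  have h := (summable_eval f z).hasSum
  rw [← (Equiv.sigmaFiberEquiv fun α : Fin d → ℕ => ∑ i, α i).hasSum_iff] at h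
  refine h.sigma fun n => ?_
  have hs : ∀ α : Fin d → ℕ, α ∈ Finset.piAntidiag Finset.univ n ↔ ∑ i, α i = n := fun α => by
    simp [Finset.mem_piAntidiag]
  have e := hasSum_fintype fun x : Finset.piAntidiag (Finset.univ : Finset (Fin d)) n =>
    f x.1 * basisFun x.1 z
  rw [Finset.sum_coe_sort (Finset.piAntidiag Finset.univ n) fun α => f α * basisFun α (z : _)] at e
  rwa [← (Equiv.subtypeEquivRight hs).symm.hasSum_iff] at e

/-- Restricted to the complex line t ↦ tz, the function becomes a one-variable power series whose
coefficients are the homogeneous parts at z; it vanishes near 0, so each coefficient is zero. -/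
theorem homogeneousPart_eq_zero_of_mem_ball {f : Space d} (hf : ∀ z, eval f z = 0) (n : ℕ)
    (z : Ball d) : homogeneousPart f n z = 0 := by
  have h : HasFPowerSeriesAt (0 : ℂ → ℂ)
      (FormalMultilinearSeries.ofScalars ℂ fun n => homogeneousPart f n z) 0 := by
    rw [hasFPowerSeriesAt_iff]
    filter_upwards [Metric.ball_mem_nhds (0 : ℂ) one_pos] with t ht
    have ht : ‖t‖ < 1 := by simpa using ht
    have hz : ‖(z : EuclideanSpace ℂ (Fin d))‖ < 1 := mem_ball_zero_iff.1 z.2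
    have hm : t • (z : EuclideanSpace ℂ (Fin d)) ∈ Metric.ball (0 : EuclideanSpace ℂ (Fin d)) 1 := by
      rw [mem_ball_zero_iff, norm_smul]
      exact mul_lt_one_of_nonneg_of_lt_one_left (norm_nonneg _) ht hz.le
    have := hasSum_homogeneousPart f ⟨_, hm⟩
    rw [hf] at this
    simpa [homogeneousPart_smul, FormalMultilinearSeries.coeff_ofScalars] using this
  have h0 := h.eq_zero
  have := congrArg (fun p => p.coeff n) h0
  rw [FormalMultilinearSeries.coeff_ofScalars] at this
  rw [this]
  simp [FormalMultilinearSeries.coeff]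

theorem homogeneousPart_eq_zero {f : Space d} (hf : ∀ z, eval f z = 0) (n : ℕ)
    (z : EuclideanSpace ℂ (Fin d)) : homogeneousPart f n z = 0 := by
  have hr : (0 : ℝ) < (‖z‖ + 1)⁻¹ := by positivity
  have hm : (((‖z‖ + 1)⁻¹ : ℝ) : ℂ) • z ∈ Metric.ball (0 : EuclideanSpace ℂ (Fin d)) 1 := by
    rw [mem_ball_zero_iff, norm_smul, Complex.norm_real, Real.norm_of_nonneg hr.le,
      inv_mul_lt_one₀ (by positivity)]
    linarith
  have h := homogeneousPart_eq_zero_of_mem_ball hf n ⟨_, hm⟩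
  rw [homogeneousPart_smul] at h
  exact (mul_eq_zero.1 h).resolve_left (pow_ne_zero _ (by exact_mod_cast hr.ne'))

theorem sqrt_factorial_div_ne_zero (α : Fin d → ℕ) :
    (Real.sqrt (((∑ i, α i).factorial : ℝ) / ((∏ i, (α i).factorial : ℕ) : ℝ)) : ℂ) ≠ 0 := by
  have : (0 : ℝ) < ((∏ i, (α i).factorial : ℕ) : ℝ) := by
    exact_mod_cast Finset.prod_pos fun i _ => Nat.factorial_pos _
  exact_mod_cast (Real.sqrt_pos.2 (by positivity)).ne'

/-- Each homogeneous part is a polynomial vanishing on all of ℂ^d, hence is the zero polynomial, and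
its coefficients are those of f up to nonzero weights. -/
theorem eq_zero_of_eval_eq_zero {f : Space d} (hf : ∀ z, eval f z = 0) : f = 0 := by
  ext β
  set n := ∑ i, β i with hn
  let c : (Fin d → ℕ) → ℂ := fun α =>
    (Real.sqrt (((∑ i, α i).factorial : ℝ) / ((∏ i, (α i).factorial : ℕ) : ℝ)) : ℂ)
  have hQ : ∑ α ∈ Finset.piAntidiag (Finset.univ : Finset (Fin d)) n,
      MvPolynomial.monomial (Finsupp.equivFunOnFinite.symm α) (f α * c α) = 0 := by
    refine MvPolynomial.funext fun x => ?_
    have := homogeneousPart_eq_zero hf n (WithLp.toLp 2 x)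
    rw [homogeneousPart] at this
    rw [map_sum, map_zero, ← this]
    refine Finset.sum_congr rfl fun α _ => ?_
    rw [MvPolynomial.eval_monomial, basisFun, Finsupp.prod_fintype _ _ (by simp), mul_assoc]
    rfl
  have h := congrArg (MvPolynomial.coeff (Finsupp.equivFunOnFinite.symm β)) hQ
  rw [MvPolynomial.coeff_sum, Finset.sum_eq_single β] at h
  · rw [MvPolynomial.coeff_monomial, if_pos rfl, MvPolynomial.coeff_zero] at h
    exact (mul_eq_zero.1 h).resolve_right (sqrt_factorial_div_ne_zero β)
  · intro α _ hα
    rw [MvPolynomial.coeff_monomial, if_neg]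
    exact fun h => hα (Finsupp.equivFunOnFinite.symm.injective h)
  · intro hβ
    exact absurd (Finset.mem_piAntidiag.2 ⟨hn.symm, fun i _ => Finset.mem_univ i⟩) hβ

theorem eval_injective {f g : Space d} (h : ∀ z, eval f z = eval g z) : f = g := by
  rw [← sub_eq_zero]
  refine eq_zero_of_eval_eq_zero fun z => ?_
  rw [sub_eq_add_neg, ← neg_one_smul ℂ g, eval_add, eval_smul, h]
  ring

theorem multiplier_shift (A : multiplierAlgebra d) (k : Fin d) (f : Space d) :
    (A : Space d →L[ℂ] Space d) (shift k f) = shift k ((A : Space d →L[ℂ] Space d) f) := by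
  obtain ⟨A, φ, hφ⟩ := A
  refine eval_injective fun z => ?_
  rw [hφ, eval_shift, eval_shift, hφ]
  ring

/-- The constant function `1`. -/
def vacuum (d : ℕ) : Space d := lp.single 2 0 1

theorem shift_single (k : Fin d) (α : Fin d → ℕ) :
    shift k (lp.single 2 α 1) =
      (Real.sqrt (((α + Pi.single k 1 : Fin d → ℕ) k : ℝ) /
        ((∑ i, (α + Pi.single k 1 : Fin d → ℕ) i : ℕ) : ℝ)) : ℂ) •
        lp.single 2 (α + Pi.single k 1) (1 : ℂ) := by
  ext β
  rw [shift_apply, shiftFun, lp.coeFn_smul, Pi.smul_apply, lp.single_apply, lp.single_apply,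
    smul_eq_mul]
  by_cases hβ : β = α + Pi.single k 1
  · subst hβ
    simp
  · rw [Pi.single_eq_of_ne hβ, mul_zero]
    by_cases hk : β k = 0
    · simp [hk]
    · rw [Pi.single_eq_of_ne, mul_zero]
      intro h
      refine hβ ?_
      rw [← h]
      funext i
      by_cases hik : i = k
      · subst hik
        simp
        omega
      · simp [hik]

/-- The vacuum vector is cyclic for the shifts. -/
theorem eq_top_of_vacuum_mem {W : Submodule ℂ (Space d)} (hc : IsClosed (W : Set (Space d)))
    (h0 : vacuum d ∈ W) (hs : ∀ k, ∀ f ∈ W, shift k f ∈ W) (f : Space d) : f ∈ W := by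
  have hsingle : ∀ n, ∀ α : Fin d → ℕ, ∑ i, α i = n → lp.single 2 α (1 : ℂ) ∈ W := by
    intro n
    induction n with
    | zero =>
      intro α hα
      have : α = 0 := by
        funext i
        exact Finset.sum_eq_zero_iff.1 hα i (Finset.mem_univ i)
      subst this
      exact h0
    | succ n ih =>
      intro α hα
      obtain ⟨k, hk⟩ : ∃ k, α k ≠ 0 := by
        by_contra! h
        simp [h] at hα
      have hadd : α - Pi.single k 1 + Pi.single k 1 = α := by
        funext i
        by_cases hik : i = k
        · subst hik
          simp
          omega
        · simp [hik]
      have hsum : ∑ i, (α - Pi.single k 1 : Fin d → ℕ) i = n := by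
        have := congrArg (fun β : Fin d → ℕ => ∑ i, β i) hadd
        simp only [Pi.add_apply, Finset.sum_add_distrib, Finset.sum_pi_single', Finset.mem_univ,
          if_true] at this
        omega
      have h := hs k _ (ih _ hsum)
      rw [shift_single, hadd] at h
      -- Shifting the basis vector of index α - e_k gives the one of index α times a scalar that is
      -- nonzero because α k > 0.
      refine (W.smul_mem_iff ?_).1 h
      have : (0 : ℝ) < α k := by exact_mod_cast Nat.pos_of_ne_zero hk
      have h' : (0 : ℝ) < ((∑ i, α i : ℕ) : ℝ) := by rw [hα]; positivity
      exact_mod_cast (Real.sqrt_pos.2 (div_pos this h')).ne'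
  have hf := lp.hasSum_single (p := 2) (by norm_num) f
  refine hc.mem_of_tendsto hf (Eventually.of_forall fun s => W.sum_mem fun α _ => ?_)
  have : lp.single 2 α (f α) = f α • (lp.single 2 α 1 : Space d) := by
    rw [← lp.single_smul, smul_eq_mul, mul_one]
  rw [this]
  exact W.smul_mem _ (hsingle _ α rfl)

end DruryArveson

end

/-! ### Powers of a commuting tuple and their square summability under purity. -/

noncomputable section

namespace OperatorTuple

variable {d : ℕ} {K : Type*} [NormedAddCommGroup K] [InnerProductSpace ℂ K]

/-- The polynomials in a commuting tuple. -/
def polynomialCalculus (S : Fin d → K →L[ℂ] K) (hS : IsCommuting S) :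
    MvPolynomial (Fin d) ℂ →ₐ[ℂ] (K →L[ℂ] K) :=
  -- `MvPolynomial.aeval` needs a commutative target, so the evaluation takes place in the
  -- subalgebra generated by the tuple.
  haveI : IsMulCommutative (Algebra.adjoin ℂ (Set.range S)) :=
    Algebra.isMulCommutative_adjoin ℂ (by
      rintro _ ⟨i, rfl⟩ _ ⟨j, rfl⟩
      exact hS i j)
  letI : CommSemiring (Algebra.adjoin ℂ (Set.range S)) :=
    { (Algebra.adjoin ℂ (Set.range S)).toSemiring with mul_comm := mul_comm' }
  (Algebra.adjoin ℂ (Set.range S)).val.comp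
    (MvPolynomial.aeval fun k => ⟨S k, Algebra.subset_adjoin (Set.mem_range_self k)⟩)

theorem polynomialCalculus_X (S : Fin d → K →L[ℂ] K) (hS : IsCommuting S) (k : Fin d) :
    polynomialCalculus S hS (MvPolynomial.X k) = S k := by
  simp [polynomialCalculus]

/-- The power `S^α` of a commuting tuple. -/
def power (S : Fin d → K →L[ℂ] K) (hS : IsCommuting S) (α : Fin d → ℕ) : K →L[ℂ] K :=
  polynomialCalculus S hS (MvPolynomial.monomial (Finsupp.equivFunOnFinite.symm α) 1)

theorem power_zero (S : Fin d → K →L[ℂ] K) (hS : IsCommuting S) : power S hS 0 = 1 := by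
  have : Finsupp.equivFunOnFinite.symm (0 : Fin d → ℕ) = 0 := by ext; rfl
  rw [power, this, MvPolynomial.monomial_zero', MvPolynomial.C_1, map_one]

theorem monomial_add_single (k : Fin d) (α : Fin d → ℕ) :
    (MvPolynomial.monomial (Finsupp.equivFunOnFinite.symm (α + Pi.single k 1)) 1 :
      MvPolynomial (Fin d) ℂ) =
      MvPolynomial.X k * MvPolynomial.monomial (Finsupp.equivFunOnFinite.symm α) 1 := by
  rw [MvPolynomial.X, MvPolynomial.monomial_mul, one_mul, add_comm]
  congr 2
  ext i
  simp [Finsupp.single_apply, Pi.single_apply, eq_comm]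

theorem power_add_single (S : Fin d → K →L[ℂ] K) (hS : IsCommuting S) (k : Fin d)
    (α : Fin d → ℕ) : power S hS (α + Pi.single k 1) = S k * power S hS α := by
  rw [power, monomial_add_single, map_mul, polynomialCalculus_X, power]

theorem power_mul_comm (S : Fin d → K →L[ℂ] K) (hS : IsCommuting S) (k : Fin d)
    (α : Fin d → ℕ) : S k * power S hS α = power S hS α * S k := by
  rw [← polynomialCalculus_X S hS k, power, ← map_mul, mul_comm, map_mul]

/-- Apply the linear functional sending each monomial X^s to h s to the two expansions of (∑ X_k)^n:
the multinomial one and the one over words. -/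
theorem sum_multinomial_mul {d : ℕ} (h : (Fin d →₀ ℕ) → ℝ) (n : ℕ) :
    ∑ α ∈ Finset.piAntidiag Finset.univ n,
        Nat.multinomial Finset.univ α * h (Finsupp.equivFunOnFinite.symm α) =
      ∑ w : Fin n → Fin d, h (∑ i, Finsupp.single (w i) 1) := by
  have key := Finset.sum_pow_eq_sum_piAntidiag (Finset.univ : Finset (Fin d))
    (fun k => (MvPolynomial.X k : MvPolynomial (Fin d) ℝ)) n
  rw [Fintype.sum_pow] at key
  have hbasis : ∀ s, (MvPolynomial.basisMonomials (Fin d) ℝ).constr ℝ h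
      (MvPolynomial.monomial s 1) = h s := fun s => by
    have := (MvPolynomial.basisMonomials (Fin d) ℝ).constr_basis ℝ h s
    rwa [MvPolynomial.coe_basisMonomials] at this
  have key2 := congrArg ((MvPolynomial.basisMonomials (Fin d) ℝ).constr ℝ h) key
  rw [map_sum, map_sum] at key2
  convert! key2.symm using 1
  · refine Finset.sum_congr rfl fun α _ => ?_
    rw [← hbasis, ← nsmul_eq_mul, ← nsmul_eq_mul, map_nsmul, MvPolynomial.monomial_eq,
      Finsupp.prod_fintype _ _ (by simp)]
    simp
  · refine Finset.sum_congr rfl fun w _ => ?_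
    rw [← hbasis, MvPolynomial.monomial_sum_one]
    rfl

theorem wordProd_ofFn (S : Fin d → K →L[ℂ] K) (hS : IsCommuting S) {n : ℕ} (w : Fin n → Fin d) :
    wordProd S (List.ofFn w) =
      polynomialCalculus S hS (MvPolynomial.monomial (∑ i, Finsupp.single (w i) 1) 1) := by
  rw [MvPolynomial.monomial_sum_one, ← List.prod_ofFn, map_list_prod, wordProd, List.map_ofFn,
    List.map_ofFn]
  congr 2
  funext i
  exact (polynomialCalculus_X S hS (w i)).symm

section Energy

variable [CompleteSpace K]

/-- The quantity `∑_{|w| = n} ‖S_w^* η‖²`. -/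
def wordEnergy (S : Fin d → K →L[ℂ] K) (n : ℕ) (η : K) : ℝ :=
  ∑ w : Fin n → Fin d, ‖ContinuousLinearMap.adjoint (wordProd S (List.ofFn w)) η‖ ^ 2

theorem wordEnergy_nonneg (S : Fin d → K →L[ℂ] K) (n : ℕ) (η : K) : 0 ≤ wordEnergy S n η :=
  Finset.sum_nonneg fun _ _ => by positivity

theorem wordEnergy_zero (S : Fin d → K →L[ℂ] K) (η : K) : wordEnergy S 0 η = ‖η‖ ^ 2 := by
  simp [wordEnergy, wordProd, ← ContinuousLinearMap.star_eq_adjoint]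

theorem wordEnergy_succ (S : Fin d → K →L[ℂ] K) (n : ℕ) (η : K) :
    wordEnergy S (n + 1) η = ∑ k, wordEnergy S n (ContinuousLinearMap.adjoint (S k) η) := by
  rw [wordEnergy, ← (Fin.consEquiv fun _ : Fin (n + 1) => Fin d).sum_comp, Fintype.sum_prod_type]
  refine Finset.sum_congr rfl fun k _ => Finset.sum_congr rfl fun w _ => ?_
  have : wordProd S (List.ofFn (Fin.cons k w : Fin (n + 1) → Fin d)) =
      S k * wordProd S (List.ofFn w) := by
    rw [List.ofFn_cons, wordProd, List.map_cons, List.prod_cons, wordProd]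
  change ‖ContinuousLinearMap.adjoint
    (wordProd S (List.ofFn (Fin.cons k w : Fin (n + 1) → Fin d))) η‖ ^ 2 = _
  rw [this, ContinuousLinearMap.mul_def, ContinuousLinearMap.adjoint_comp]
  rfl

/-- Peel off the first n letters with `wordEnergy_succ`, then apply the bound to the remaining m.
With c < 1 this forces geometric decay. -/
theorem wordEnergy_add_le {S : Fin d → K →L[ℂ] K} {m : ℕ} {c : ℝ}
    (h : ∀ η, wordEnergy S m η ≤ c * ‖η‖ ^ 2) (n : ℕ) (η : K) :
    wordEnergy S (m + n) η ≤ c * wordEnergy S n η := by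
  induction n generalizing η with
  | zero => rw [wordEnergy_zero]; exact h η
  | succ n ih =>
    rw [← add_assoc, wordEnergy_succ, wordEnergy_succ, Finset.mul_sum]
    exact Finset.sum_le_sum fun k _ => ih _

omit [CompleteSpace K] in
-- The operator norm is at most the Hilbert–Schmidt norm.
theorem norm_apply_sq_le {ι : Type*} [Fintype ι] (b : OrthonormalBasis ι ℂ K)
    (A : K →L[ℂ] K) (η : K) : ‖A η‖ ^ 2 ≤ (∑ j, ‖A (b j)‖ ^ 2) * ‖η‖ ^ 2 := by
  have h1 : ‖A η‖ ≤ ∑ j, ‖A (b j)‖ * ‖inner ℂ (b j) η‖ := by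
    conv_lhs => rw [← b.sum_repr' η, map_sum]
    refine (norm_sum_le _ _).trans (Finset.sum_le_sum fun j _ => ?_)
    rw [map_smul, norm_smul, mul_comm]
  calc ‖A η‖ ^ 2 ≤ (∑ j, ‖A (b j)‖ * ‖inner ℂ (b j) η‖) ^ 2 := by gcongr
    _ ≤ (∑ j, ‖A (b j)‖ ^ 2) * ∑ j, ‖inner ℂ (b j) η‖ ^ 2 := Finset.sum_mul_sq_le_sq_mul_sq _ _ _
    _ = _ := by rw [b.sum_sq_norm_inner_right]

omit [CompleteSpace K] in
theorem opNorm_sq_le {ι : Type*} [Fintype ι] (b : OrthonormalBasis ι ℂ K)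
    (A : K →L[ℂ] K) : ‖A‖ ^ 2 ≤ ∑ j, ‖A (b j)‖ ^ 2 := by
  have h0 : 0 ≤ ∑ j, ‖A (b j)‖ ^ 2 := Finset.sum_nonneg fun _ _ => by positivity
  refine (Real.le_sqrt (norm_nonneg _) h0).1 (A.opNorm_le_bound (Real.sqrt_nonneg _) fun η => ?_)
  rw [← Real.sqrt_sq (norm_nonneg η), ← Real.sqrt_mul h0]
  exact Real.le_sqrt_of_sq_le (norm_apply_sq_le b A η)

variable [FiniteDimensional ℂ K]

/-- Purity is pointwise; summing over a finite orthonormal basis makes it uniform in η. Any constant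
below 1 would serve. -/
theorem IsPure.exists_wordEnergy_le {S : Fin d → K →L[ℂ] K} (hp : IsPure S) :
    ∃ m, ∀ η, wordEnergy S m η ≤ 1 / 2 * ‖η‖ ^ 2 := by
  have b := stdOrthonormalBasis ℂ K
  have ht : Tendsto (fun n => ∑ j, wordEnergy S n (b j)) atTop (𝓝 0) := by
    simpa using! tendsto_finsetSum Finset.univ fun j _ => hp (b j)
  obtain ⟨m, hm⟩ := (ht.eventually (gt_mem_nhds (by norm_num : (0 : ℝ) < 1 / 2))).exists
  refine ⟨m, fun η => ?_⟩
  calc wordEnergy S m η ≤ (∑ j, wordEnergy S m (b j)) * ‖η‖ ^ 2 := by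
        simp only [wordEnergy]
        rw [Finset.sum_comm, Finset.sum_mul]
        exact Finset.sum_le_sum fun w _ => norm_apply_sq_le b _ η
    _ ≤ _ := by gcongr

theorem IsPure.summable_wordEnergy {S : Fin d → K →L[ℂ] K} (hp : IsPure S) (η : K) :
    Summable fun n => wordEnergy S n η := by
  obtain ⟨m, hm⟩ := hp.exists_wordEnergy_le
  -- The N-th partial sum is at most the first m terms plus half of itself, which gives the factor
  -- 2.
  refine summable_of_sum_range_le (c := 2 * ∑ n ∈ Finset.range m, wordEnergy S n η)
    (fun n => wordEnergy_nonneg S n η) fun N => ?_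
  have h1 : ∑ n ∈ Finset.range N, wordEnergy S n η ≤
      ∑ n ∈ Finset.range (m + N), wordEnergy S n η :=
    Finset.sum_le_sum_of_subset_of_nonneg (Finset.range_mono (Nat.le_add_left _ _))
      fun n _ _ => wordEnergy_nonneg S n η
  have h2 : ∑ n ∈ Finset.range N, wordEnergy S (m + n) η ≤
      1 / 2 * ∑ n ∈ Finset.range N, wordEnergy S n η := by
    rw [Finset.mul_sum]
    exact Finset.sum_le_sum fun n _ => wordEnergy_add_le hm n η
  rw [Finset.sum_range_add] at h1
  linarith

end Energy

theorem summable_of_summable_piAntidiag {F : (Fin d → ℕ) → ℝ} (h0 : ∀ α, 0 ≤ F α)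
    (hF : Summable fun n => ∑ α ∈ Finset.piAntidiag Finset.univ n, F α) : Summable F := by
  refine summable_of_sum_le h0 (c := ∑' n, ∑ α ∈ Finset.piAntidiag Finset.univ n, F α)
    fun s => ?_
  set N := s.sup fun α => ∑ i, α i
  calc ∑ α ∈ s, F α
      ≤ ∑ α ∈ (Finset.range (N + 1)).biUnion fun n =>
          Finset.piAntidiag (Finset.univ : Finset (Fin d)) n, F α := by
        refine Finset.sum_le_sum_of_subset_of_nonneg (fun α hα => ?_) fun α _ _ => h0 α
        simp only [Finset.mem_biUnion, Finset.mem_range, Finset.mem_piAntidiag]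
        exact ⟨∑ i, α i, Nat.lt_succ_of_le (Finset.le_sup (f := fun α => ∑ i, α i) hα), rfl,
          fun i _ => Finset.mem_univ i⟩
    _ = ∑ n ∈ Finset.range (N + 1), ∑ α ∈ Finset.piAntidiag Finset.univ n, F α := by
        refine Finset.sum_biUnion ?_
        intro m _ n _ hmn
        refine Finset.disjoint_left.2 fun α hm hn => hmn ?_
        rw [Finset.mem_piAntidiag] at hm hn
        exact hm.1.symm.trans hn.1
    _ ≤ _ := hF.sum_le_tsum _ fun n _ => Finset.sum_nonneg fun α _ => h0 α

/-- The coefficient `(|α|! / α!)^{1/2}`. -/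
def weight (α : Fin d → ℕ) : ℂ := DruryArveson.basisFun α (WithLp.toLp 2 fun _ => 1)

theorem norm_weight_sq (α : Fin d → ℕ) : ‖weight α‖ ^ 2 = Nat.multinomial Finset.univ α := by
  rw [weight, DruryArveson.norm_basisFun_sq]
  simp

theorem weight_zero : weight (0 : Fin d → ℕ) = 1 := by
  simp [weight, DruryArveson.basisFun]

/-- This is `basisFun_add_single` at the point (1, …, 1). It turns the shift on coefficients into
multiplication by S_k. -/
theorem sqrt_mul_weight (k : Fin d) (α : Fin d → ℕ) :
    (Real.sqrt (((α + Pi.single k 1 : Fin d → ℕ) k : ℕ) /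
      ((∑ i, (α + Pi.single k 1 : Fin d → ℕ) i : ℕ) : ℝ)) : ℂ) * weight (α + Pi.single k 1) =
      weight α := by
  rw [weight, DruryArveson.basisFun_add_single, weight]
  simp

/-- There are multinomial-many words for each α, and `weight` squared is that number; so the degree
n terms of ‖weight α‖² ‖(S^α)^* b_j‖² add up to the word energy of b_j. Summing over the basis
bounds ‖S^α‖². -/
theorem IsPure.summable_norm_power [CompleteSpace K] [FiniteDimensional ℂ K]
    {S : Fin d → K →L[ℂ] K} (hp : IsPure S) (hS : IsCommuting S) :
    Summable fun α => (‖weight α‖ * ‖power S hS α‖) ^ 2 := by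
  have b := stdOrthonormalBasis ℂ K
  have h : ∀ j, Summable fun α => (Nat.multinomial Finset.univ α : ℝ) *
      ‖ContinuousLinearMap.adjoint (power S hS α) (b j)‖ ^ 2 := fun j => by
    refine summable_of_summable_piAntidiag (fun α => by positivity) ?_
    convert! hp.summable_wordEnergy (b j) using 2 with n
    rw [wordEnergy]
    simp_rw [wordProd_ofFn S hS]
    exact sum_multinomial_mul (fun s => ‖ContinuousLinearMap.adjoint
      (polynomialCalculus S hS (MvPolynomial.monomial s 1)) (b j)‖ ^ 2) n
  refine Summable.of_nonneg_of_le (fun α => by positivity) (fun α => ?_)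
    (summable_sum (s := Finset.univ) fun j _ => h j)
  rw [mul_pow, norm_weight_sq, ← Finset.mul_sum,
    ← (ContinuousLinearMap.adjoint (𝕜 := ℂ) (E := K) (F := K)).norm_map]
  gcongr
  exact opNorm_sq_le b _

end OperatorTuple

end

/-! ### The functional calculus of a pure commuting tuple. -/

noncomputable section

namespace OperatorTuple

open DruryArveson

variable {d : ℕ} {K : Type*} [NormedAddCommGroup K] [InnerProductSpace ℂ K]
  {S : Fin d → K →L[ℂ] K}

theorem hasSum_norm_sq (f : Space d) : HasSum (fun α => ‖f α‖ ^ 2) (‖f‖ ^ 2) := by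
  simpa using lp.hasSum_norm (p := 2) (by norm_num) f

theorem norm_term (hS : IsCommuting S) (f : Space d) (α : Fin d → ℕ) :
    ‖(f α * weight α) • power S hS α‖ = ‖f α‖ * (‖weight α‖ * ‖power S hS α‖) := by
  rw [norm_smul, norm_mul, mul_assoc]

theorem summable_inner_apply (x y : lp (fun _ : ℕ => K) 2) (X : K →L[ℂ] K) :
    Summable fun n => inner ℂ (y n) (X (x n)) := by
  have hx : Summable fun n => ‖x n‖ ^ 2 := by
    simpa using (lp.memℓp x).summable (by norm_num)
  have hy : Summable fun n => ‖y n‖ ^ 2 := by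
    simpa using (lp.memℓp y).summable (by norm_num)
  refine Summable.of_norm (Summable.of_nonneg_of_le (fun _ => norm_nonneg _) (fun n => ?_)
    ((hx.add hy).mul_left ‖X‖))
  calc ‖inner ℂ (y n) (X (x n))‖ ≤ ‖y n‖ * (‖X‖ * ‖x n‖) :=
        (norm_inner_le_norm _ _).trans (by gcongr; exact X.le_opNorm _)
    _ = ‖X‖ * (‖x n‖ * ‖y n‖) := by ring
    _ ≤ ‖X‖ * (‖x n‖ ^ 2 + ‖y n‖ ^ 2) := by
        gcongr
        nlinarith [sq_nonneg (‖x n‖ - ‖y n‖), sq_nonneg ‖x n‖, sq_nonneg ‖y n‖]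

/-- The weak-* continuous functional `X ↦ ∑ ⟨X x_n, y_n⟩`. -/
def traceFunctional (x y : lp (fun _ : ℕ => K) 2) : (K →L[ℂ] K) →ₗ[ℂ] ℂ where
  toFun X := ∑' n, inner ℂ (y n) (X (x n))
  map_add' X Y := by
    rw [← (summable_inner_apply x y X).tsum_add (summable_inner_apply x y Y)]
    exact tsum_congr fun n => by rw [add_apply, inner_add_right]
  map_smul' c X := by
    rw [RingHom.id_apply, smul_eq_mul, ← tsum_mul_left]
    exact tsum_congr fun n => by rw [smul_apply, inner_smul_right]

/-- This is a defining weak-* functional, with both sequences supported at index 0. -/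
theorem continuous_inner_apply (f g : Space d) :
    @Continuous _ _ (multiplierWeakStar d) inferInstance
      fun A : multiplierAlgebra d => (inner ℂ g ((A : Space d →L[ℂ] Space d) f) : ℂ) := by
  let p : lp (fun _ : ℕ => Space d) 2 × lp (fun _ : ℕ => Space d) 2 :=
    (lp.single 2 0 f, lp.single 2 0 g)
  have hfun : (fun A : multiplierAlgebra d =>
      (inner ℂ g ((A : Space d →L[ℂ] Space d) f) : ℂ)) =
      (fun A : Space d →L[ℂ] Space d => ∑' n, inner ℂ (p.2 n) (A (p.1 n))) ∘ Subtype.val := by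
    funext A
    rw [Function.comp_apply, tsum_eq_single 0]
    · simp [p]
    · intro n hn
      simp [p, Pi.single_eq_of_ne hn]
  rw [hfun]
  let _ := weakStarTopology (Space d)
  refine Continuous.comp ?_ continuous_induced_dom
  exact continuous_iInf_dom (i := p) continuous_induced_dom

variable [CompleteSpace K] [FiniteDimensional ℂ K]

theorem IsPure.norm_series (hp : IsPure S) (hS : IsCommuting S) (f : Space d) :
    Summable (fun α => ‖f α‖ * (‖weight α‖ * ‖power S hS α‖)) ∧
      ∑' α, ‖f α‖ * (‖weight α‖ * ‖power S hS α‖) ≤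
        ‖f‖ * Real.sqrt (∑' α, (‖weight α‖ * ‖power S hS α‖) ^ 2) := by
  have h := Real.summable_and_inner_le_Lp_mul_Lq_tsum_of_nonneg Real.HolderConjugate.two_two
    (f := fun α => ‖f α‖) (g := fun α => ‖weight α‖ * ‖power S hS α‖)
    (fun α => norm_nonneg _) (fun α => by positivity)
    (by simpa using (hasSum_norm_sq f).summable)
    (by simpa using hp.summable_norm_power hS)
  refine ⟨h.1, h.2.trans (le_of_eq ?_)⟩
  simp only [Real.rpow_two, (hasSum_norm_sq f).tsum_eq, ← Real.sqrt_eq_rpow,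
    Real.sqrt_sq (norm_nonneg f)]

theorem IsPure.summable_series (hp : IsPure S) (hS : IsCommuting S) (f : Space d) :
    Summable fun α => (f α * weight α) • power S hS α := by
  refine Summable.of_norm ?_
  simp only [norm_term]
  exact (hp.norm_series hS f).1

/-- The map `f ↦ f(S) = ∑ c_α S^α`, where `f = ∑ c_α x^α` is in the Drury-Arveson space. -/
def seriesCalculus (hp : IsPure S) (hS : IsCommuting S) : Space d →L[ℂ] (K →L[ℂ] K) :=
  LinearMap.mkContinuous
    { toFun := fun f => ∑' α, (f α * weight α) • power S hS α
      map_add' := fun f g => by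
        rw [← (hp.summable_series hS f).tsum_add (hp.summable_series hS g)]
        exact tsum_congr fun α => by rw [lp.coeFn_add, Pi.add_apply, add_mul, add_smul]
      map_smul' := fun c f => by
        rw [RingHom.id_apply, ← (hp.summable_series hS f).tsum_const_smul]
        exact tsum_congr fun α => by
          rw [lp.coeFn_smul, Pi.smul_apply, smul_eq_mul, mul_assoc, mul_smul] }
    (Real.sqrt (∑' α, (‖weight α‖ * ‖power S hS α‖) ^ 2)) fun f => by
      have h := hp.norm_series hS f
      rw [mul_comm]
      refine (norm_tsum_le_tsum_norm ?_).trans ?_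
      · simpa only [norm_term] using h.1
      · simpa only [norm_term] using h.2

theorem seriesCalculus_apply (hp : IsPure S) (hS : IsCommuting S) (f : Space d) :
    seriesCalculus hp hS f = ∑' α, (f α * weight α) • power S hS α := rfl

theorem seriesCalculus_vacuum (hp : IsPure S) (hS : IsCommuting S) :
    seriesCalculus hp hS (vacuum d) = 1 := by
  rw [seriesCalculus_apply, tsum_eq_single 0]
  · simp [vacuum, weight_zero, power_zero]
  · intro α hα
    rw [vacuum, lp.single_apply_ne _ _ _ hα, zero_mul, zero_smul]

theorem seriesCalculus_shift (hp : IsPure S) (hS : IsCommuting S) (k : Fin d) (f : Space d) :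
    seriesCalculus hp hS (shift k f) = S k * seriesCalculus hp hS f := by
  have hinj : Function.Injective fun α : Fin d → ℕ => α + Pi.single k 1 :=
    add_left_injective _
  rw [seriesCalculus_apply, seriesCalculus_apply, ← (hp.summable_series hS f).tsum_mul_left,
    ← hinj.tsum_eq]
  · refine tsum_congr fun α => ?_
    rw [shift_apply, shiftFun, add_tsub_cancel_right, mul_right_comm, sqrt_mul_weight,
      power_add_single, mul_smul_comm, mul_comm (weight α)]
  -- Indices outside the range of α ↦ α + e_k have β k = 0, where the shifted coefficient vanishes.
  · intro β hβ
    refine ⟨β - Pi.single k 1, ?_⟩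
    have hk : β k ≠ 0 := fun h => hβ (by simp [shift_apply, shiftFun, h])
    funext i
    by_cases hik : i = k
    · subst hik
      simp
      omega
    · simp [hik]

theorem seriesCalculus_mul_comm (hp : IsPure S) (hS : IsCommuting S) (k : Fin d) (f : Space d) :
    S k * seriesCalculus hp hS f = seriesCalculus hp hS f * S k := by
  rw [seriesCalculus_apply, ← (hp.summable_series hS f).tsum_mul_left,
    ← (hp.summable_series hS f).tsum_mul_right]
  exact tsum_congr fun α => by rw [mul_smul_comm, smul_mul_assoc, power_mul_comm]

/-- The difference D of the two sides is continuous in f and vanishes at 1. Its kernel is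
shift-invariant, because A commutes with the shifts and B with each S_k, so it is the whole space.
-/
theorem seriesCalculus_multiplier (hp : IsPure S) (hS : IsCommuting S) (A : multiplierAlgebra d)
    (f : Space d) :
    seriesCalculus hp hS ((A : Space d →L[ℂ] Space d) f) =
      seriesCalculus hp hS ((A : Space d →L[ℂ] Space d) (vacuum d)) * seriesCalculus hp hS f := by
  set L := seriesCalculus hp hS
  set B := L ((A : Space d →L[ℂ] Space d) (vacuum d)) with hB
  let D : Space d →L[ℂ] (K →L[ℂ] K) :=
    L ∘L (A : Space d →L[ℂ] Space d) - ContinuousLinearMap.mul ℂ (K →L[ℂ] K) B ∘L L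
  have hD : ∀ g, D g = L ((A : Space d →L[ℂ] Space d) g) - B * L g := fun g => rfl
  suffices h : f ∈ D.ker by
    rw [LinearMap.mem_ker] at h
    exact sub_eq_zero.1 h
  refine eq_top_of_vacuum_mem D.isClosed_ker ?_ (fun k g hg => ?_) f
  · refine LinearMap.mem_ker.2 ((hD _).trans ?_)
    rw [seriesCalculus_vacuum, mul_one, hB, sub_self]
  · have hg' : L ((A : Space d →L[ℂ] Space d) g) - B * L g = 0 := LinearMap.mem_ker.1 hg
    refine LinearMap.mem_ker.2 ((hD _).trans ?_)
    rw [multiplier_shift, seriesCalculus_shift, seriesCalculus_shift, ← mul_assoc B,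
      ← seriesCalculus_mul_comm, mul_assoc, ← mul_sub, hg', mul_zero]

/-- The functional calculus of a pure commuting tuple on a finite-dimensional space. -/
def functionalCalculus (hp : IsPure S) (hS : IsCommuting S) :
    multiplierAlgebra d →ₐ[ℂ] (K →L[ℂ] K) :=
  AlgHom.ofLinearMap
    { toFun := fun A => seriesCalculus hp hS ((A : Space d →L[ℂ] Space d) (vacuum d))
      map_add' := fun _ _ => map_add (seriesCalculus hp hS) _ _
      map_smul' := fun c _ => map_smul (seriesCalculus hp hS) c _ }
    (seriesCalculus_vacuum hp hS)
    fun A B => seriesCalculus_multiplier hp hS A ((B : Space d →L[ℂ] Space d) (vacuum d))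

theorem isFunctionalCalculus_functionalCalculus (hp : IsPure S) (hS : IsCommuting S) :
    IsFunctionalCalculus S (functionalCalculus hp hS) where
  map_coord k := by
    have : functionalCalculus hp hS (coord k) = seriesCalculus hp hS (shift k (vacuum d)) := rfl
    rw [this, seriesCalculus_shift, seriesCalculus_vacuum, mul_one]
  weakStar_continuous := by
    refine continuous_iInf_rng.2 fun p => continuous_induced_rng.2 ?_
    -- On finite-dimensional B(K) every linear functional is norm continuous, so ℓ is bounded on
    -- H²_d. Riesz then writes ℓ(A 1) as ⟨g, A 1⟩, which is weak-* continuous in A.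
    let ℓ : Space d →L[ℂ] ℂ :=
      LinearMap.toContinuousLinearMap (traceFunctional p.1 p.2) ∘L seriesCalculus hp hS
    convert! continuous_inner_apply (vacuum d) ((InnerProductSpace.toDual ℂ (Space d)).symm ℓ)
      using 2 with A
    rw [InnerProductSpace.toDual_symm_apply]
    rfl

end OperatorTuple

end

/-! ### Compressions to co-invariant subspaces and the cyclic vector. -/

noncomputable section

namespace OperatorTuple

variable {d : ℕ} {H : Type*} [NormedAddCommGroup H] [InnerProductSpace ℂ H]

/-- Polynomials are taken in the free algebra, which evaluates directly in any algebra and matches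
words without choosing an order of the variables. -/
theorem wordProd_eq_lift (T : Fin d → H →L[ℂ] H) (w : List (Fin d)) :
    wordProd T w = FreeAlgebra.lift ℂ T (w.map (FreeAlgebra.ι ℂ)).prod := by
  rw [map_list_prod, wordProd, List.map_map]
  congr 2
  funext k
  exact (FreeAlgebra.lift_ι_apply T k).symm

theorem commute_lift {T : Fin d → H →L[ℂ] H} (hT : IsCommuting T)
    (F G : FreeAlgebra ℂ (Fin d)) :
    Commute (FreeAlgebra.lift ℂ T F) (FreeAlgebra.lift ℂ T G) := by
  have h : ∀ (B : H →L[ℂ] H), (∀ k, Commute B (T k)) → ∀ F, Commute B (FreeAlgebra.lift ℂ T F) := by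
    intro B hB F
    induction F using FreeAlgebra.induction with
    | grade0 c => rw [AlgHom.commutes]; exact (Algebra.commutes c B).symm
    | grade1 k => rw [FreeAlgebra.lift_ι_apply]; exact hB k
    | mul a b ha hb => rw [map_mul]; exact ha.mul_right hb
    | add a b ha hb => rw [map_add]; exact ha.add_right hb
  exact h _ (fun k => (h _ (fun j => hT k j) F).symm) G

variable [CompleteSpace H]

/-- Co-invariance of M means that T_k preserves Mᗮ, so the component of x in Mᗮ does not contribute.
-/
theorem projection_comp_apply {T : Fin d → H →L[ℂ] H} {M : Submodule ℂ H}
    [M.HasOrthogonalProjection] (hM : IsCoinvariant T M) (k : Fin d) (x : H) :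
    M.orthogonalProjectionOnto (T k x) = compression T M k (M.orthogonalProjectionOnto x) := by
  have hx : T k (x - M.orthogonalProjectionOnto x) ∈ Mᗮ := by
    refine (Submodule.mem_orthogonal _ _).2 fun u hu => ?_
    rw [← ContinuousLinearMap.adjoint_inner_left]
    exact (Submodule.mem_orthogonal _ _).1 (M.sub_starProjection_mem_orthogonal x) _
      (hM k u hu)
  have := Submodule.orthogonalProjectionOnto_eq_zero_iff.2 hx
  rw [map_sub, map_sub, sub_eq_zero] at this
  exact this

theorem projection_lift_apply {T : Fin d → H →L[ℂ] H} {M : Submodule ℂ H}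
    [M.HasOrthogonalProjection] (hM : IsCoinvariant T M) (F : FreeAlgebra ℂ (Fin d)) (x : H) :
    M.orthogonalProjectionOnto (FreeAlgebra.lift ℂ T F x) =
      FreeAlgebra.lift ℂ (compression T M) F (M.orthogonalProjectionOnto x) := by
  induction F using FreeAlgebra.induction generalizing x with
  | grade0 c => simp [Algebra.algebraMap_eq_smul_one]
  | grade1 k => rw [FreeAlgebra.lift_ι_apply, FreeAlgebra.lift_ι_apply, projection_comp_apply hM]
  | mul a b ha hb => rw [map_mul, map_mul, mul_apply_eq_comp, mul_apply_eq_comp, ha, hb]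
  | add a b ha hb => rw [map_add, map_add, add_apply, add_apply, map_add, ha, hb]

theorem IsCommuting.compression {T : Fin d → H →L[ℂ] H} (hT : IsCommuting T) {M : Submodule ℂ H}
    [M.HasOrthogonalProjection] (hM : IsCoinvariant T M) : IsCommuting (compression T M) := by
  intro i j
  ext1 x
  have hx : M.orthogonalProjectionOnto (x : H) = x :=
    Submodule.orthogonalProjectionOnto_mem_subspace_eq_self x
  have h := congrArg M.orthogonalProjectionOnto (DFunLike.congr_fun (hT i j) (x : H))
  rw [mul_apply_eq_comp, mul_apply_eq_comp, projection_comp_apply hM, projection_comp_apply hM,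
    projection_comp_apply hM, projection_comp_apply hM, hx] at h
  exact h

/-- The adjoint of a compressed word is the restriction of T_w^* to M, so the sums in the two purity
conditions coincide. -/
theorem IsPure.compression {T : Fin d → H →L[ℂ] H} (hT : IsPure T) {M : Submodule ℂ H}
    [M.HasOrthogonalProjection] [CompleteSpace M] (hM : IsCoinvariant T M) :
    IsPure (compression T M) := by
  intro ξ
  have h : ∀ w, ((ContinuousLinearMap.adjoint (wordProd (OperatorTuple.compression T M) w) ξ : M) : H) =
      ContinuousLinearMap.adjoint (wordProd T w) ξ := by
    intro w
    refine ext_inner_right ℂ fun x => ?_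
    rw [ContinuousLinearMap.adjoint_inner_left, wordProd_eq_lift,
      ← Submodule.inner_orthogonalProjectionOnto_eq_of_mem_left,
      ContinuousLinearMap.adjoint_inner_left, wordProd_eq_lift, ← projection_lift_apply hM,
      Submodule.inner_orthogonalProjectionOnto_eq_of_mem_left]
  simpa only [← h, Submodule.coe_norm] using hT ξ

omit [CompleteSpace H] in
theorem IsFunctionalCalculus.apply_lift {T : Fin d → H →L[ℂ] H}
    {Φ : DruryArveson.multiplierAlgebra d →ₐ[ℂ] (H →L[ℂ] H)} (h : IsFunctionalCalculus T Φ)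
    (F : FreeAlgebra ℂ (Fin d)) :
    Φ (FreeAlgebra.lift ℂ DruryArveson.coord F) = FreeAlgebra.lift ℂ T F := by
  rw [← AlgHom.comp_apply]
  congr 1
  refine FreeAlgebra.hom_ext (funext fun k => ?_)
  simp [h.map_coord]

/-- A polynomial belongs to the annihilator of the tuple if and only if it vanishes at the tuple. -/
theorem lift_coord_mem_annihilator_iff [FiniteDimensional ℂ H] {T : Fin d → H →L[ℂ] H}
    (hp : IsPure T) (hT : IsCommuting T) (F : FreeAlgebra ℂ (Fin d)) :
    FreeAlgebra.lift ℂ DruryArveson.coord F ∈ annihilator T ↔ FreeAlgebra.lift ℂ T F = 0 := by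
  constructor
  · rintro ⟨Φ, hΦ, h⟩
    rwa [hΦ.apply_lift] at h
  · intro h
    -- Without an actual calculus the annihilator would be empty; this is where the construction is
    -- needed.
    have hΦ := isFunctionalCalculus_functionalCalculus hp hT
    exact ⟨_, hΦ, by rw [hΦ.apply_lift, h]⟩

omit [CompleteSpace H] in
theorem exists_lift_apply_eq [FiniteDimensional ℂ H] {T : Fin d → H →L[ℂ] H} {ξ : H}
    (hξ : (Submodule.span ℂ (Set.range fun w : List (Fin d) => wordProd T w ξ)).topologicalClosure
      = ⊤) (x : H) : ∃ F, FreeAlgebra.lift ℂ T F ξ = x := by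
  rw [(Submodule.closed_of_finiteDimensional _).submodule_topologicalClosure_eq] at hξ
  have hx : x ∈ Submodule.span ℂ (Set.range fun w : List (Fin d) => wordProd T w ξ) :=
    hξ ▸ Submodule.mem_top
  induction hx using Submodule.span_induction with
  | mem x h =>
    obtain ⟨w, rfl⟩ := h
    exact ⟨_, by rw [← wordProd_eq_lift]⟩
  | zero => exact ⟨0, by simp⟩
  | add x y _ _ hx hy =>
    obtain ⟨F, rfl⟩ := hx
    obtain ⟨G, rfl⟩ := hy
    exact ⟨F + G, by simp⟩
  | smul c x _ hx =>
    obtain ⟨F, rfl⟩ := hx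
    exact ⟨c • F, by simp⟩

/-- A polynomial in the tuple maps a cyclic vector into `Mᗮ` if and only if it vanishes at the
compression to `M`. -/
theorem lift_compression_eq_zero_iff [FiniteDimensional ℂ H] {T : Fin d → H →L[ℂ] H}
    (hT : IsCommuting T) {ξ : H}
    (hξ : (Submodule.span ℂ (Set.range fun w : List (Fin d) => wordProd T w ξ)).topologicalClosure
      = ⊤) {M : Submodule ℂ H} (hM : IsCoinvariant T M) (F : FreeAlgebra ℂ (Fin d)) :
    FreeAlgebra.lift ℂ (compression T M) F = 0 ↔ FreeAlgebra.lift ℂ T F ξ ∈ Mᗮ := by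
  rw [← Submodule.orthogonalProjectionOnto_eq_zero_iff]
  constructor
  · intro h
    rw [projection_lift_apply hM, h, zero_apply]
  · intro h
    ext1 x
    -- With x = G(T)ξ, commuting F past G puts F(T)ξ next to ξ, where P_M kills it.
    obtain ⟨G, hG⟩ := exists_lift_apply_eq hξ (x : H)
    have hx : M.orthogonalProjectionOnto (x : H) = x :=
      Submodule.orthogonalProjectionOnto_mem_subspace_eq_self x
    rw [← hx, ← projection_lift_apply hM, ← hG, ← mul_apply_eq_comp, (commute_lift hT F G).eq,
      mul_apply_eq_comp, projection_lift_apply hM, h, map_zero, zero_apply]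

/-- Writing x = F(T)ξ turns membership in Mᗮ or Nᗮ into membership of F, as a multiplier, in the
corresponding annihilator. -/
theorem orthogonal_le_of_annihilator_subset [FiniteDimensional ℂ H] {T : Fin d → H →L[ℂ] H}
    (hcomm : IsCommuting T) (hpure : IsPure T) (hcyc : IsCyclic T) {M N : Submodule ℂ H}
    (hM : IsCoinvariant T M) (hN : IsCoinvariant T N)
    (hann : annihilator (compression T M) ⊆ annihilator (compression T N)) : Mᗮ ≤ Nᗮ := by
  obtain ⟨ξ, hξ⟩ := hcyc
  intro x hx
  obtain ⟨F, rfl⟩ := exists_lift_apply_eq hξ x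
  rw [← lift_compression_eq_zero_iff hcomm hξ hM,
    ← lift_coord_mem_annihilator_iff (hpure.compression hM) (hcomm.compression hM)] at hx
  rw [← lift_compression_eq_zero_iff hcomm hξ hN,
    ← lift_coord_mem_annihilator_iff (hpure.compression hN) (hcomm.compression hN)]
  exact hann hx

end OperatorTuple

end

theorem corollaryC {d : ℕ} (hd : 0 < d)
    {H : Type*} [NormedAddCommGroup H] [InnerProductSpace ℂ H] [CompleteSpace H]
    [FiniteDimensional ℂ H]
    (T : Fin d → H →L[ℂ] H)
    (hrow : OperatorTuple.IsRowContraction T)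
    (hcomm : OperatorTuple.IsCommuting T)
    (hpure : OperatorTuple.IsPure T)
    (hcyc : OperatorTuple.IsCyclic T)
    (M N : Submodule ℂ H)
    (hM : OperatorTuple.IsCoinvariant T M)
    (hN : OperatorTuple.IsCoinvariant T N)
    (hann : OperatorTuple.annihilator (OperatorTuple.compression T M) =
      OperatorTuple.annihilator (OperatorTuple.compression T N)) :
    M = N := by
  have h : Mᗮ = Nᗮ := le_antisymm
    (OperatorTuple.orthogonal_le_of_annihilator_subset hcomm hpure hcyc hM hN hann.le)
    (OperatorTuple.orthogonal_le_of_annihilator_subset hcomm hpure hcyc hN hM hann.ge)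
  rw [← M.orthogonal_orthogonal, h, N.orthogonal_orthogonal]
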